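/- Let $P_1,P_2,P_3$ be the vertices of an equilateral triangle of side $1$ in the Euclidean plane, let $\psi_i(x)=\tfrac12(x+P_i)$ for $i=1,2,3$, and let $K$ be the Sierpinski gasket, that is, the unique nonempty compact subset of the plane with $K=\psi_1(K)\cup\psi_2(K)\cup\psi_3(K)$. Let $\alpha=(\alpha_1,\alpha_2,\alpha_3)$ be a polyratio, i.e. $0<\alpha_i<1$ for $i=1,2,3$. A distance on $K$ means any metric on the set $K$, with no assumed relation to the Euclidean topology. We say that $\alpha$ is \emph{metric} if there is a distance $d$ on $K$ with $d(\psi_i(x),\psi_i(y))\le\alpha_i\,d(x,y)$ for all $i$ and all $x,y\in K$. We say that $\alpha$ is \emph{asymptotically metric} if there are a distance $d$ on $K$ for which $K$ has finite diameter and constants $c_1,c_2>0$ such that, for every $m\ge 0$ and all $i_1,\dots,i_m\in\{1,2,3\}$, $$c_1\,\alpha_{i_1}\cdots\alpha_{i_m}\,\mathrm{diam}_d(K)\le \mathrm{diam}_d\big(\psi_{i_1}\circ\cdots\circ\psi_{i_m}(K)\big)\le c_2\,\alpha_{i_1}\cdots\alpha_{i_m}\,\mathrm{diam}_d(K).$$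 Then the following are equivalent: (a) $\alpha$ is metric; (b) $\alpha$ is asymptotically metric; (c) $\alpha_i+\alpha_j\ge 1$ for all $i,j\in\{1,2,3\}$ with $i\ne j$. -/

import Mathlib

/-! ### Words, polyratios and distances on a set carrying finitely many self-maps -/

/-- For a word `w = (i₁, …, iₘ)`, the composition `ψ i₁ ∘ ⋯ ∘ ψ iₘ`
(the identity for the empty word). -/
def wordMap {ι X : Type*} (ψ : ι → X → X) (w : List ι) : X → X :=
  w.foldr (fun i f => ψ i ∘ f) id

/-- For a word `w = (i₁, …, iₘ)`, the product `α i₁ ⋯ α iₘ` (one for the empty word). -/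
def wordRatio {ι : Type*} (α : ι → ℝ) (w : List ι) : ℝ :=
  (w.map α).prod

/-- A polyratio: a family of numbers in the open interval `]0, 1[`. -/
def IsPolyratio {ι : Type*} (α : ι → ℝ) : Prop :=
  ∀ i, 0 < α i ∧ α i < 1

/-- A distance `d` on `X` is `α`-self-similar if every `ψ i` is `α i`-Lipschitz for `d`. The
distance is arbitrary: it need not be related to any topology that `X` already has. -/
def IsSelfSimilarDistance {ι X : Type*} (ψ : ι → X → X) (α : ι → ℝ) (d : MetricSpace X) : Prop :=
  ∀ i x y, d.dist (ψ i x) (ψ i y) ≤ α i * d.dist x y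

/-- A distance `d` on `X` is `α`-scaling if the diameter of `X` is finite, and the diameter of each
copy `ψ i₁ ∘ ⋯ ∘ ψ iₘ (X)` lies between `c₁ * α i₁ ⋯ α iₘ * diam X` and
`c₂ * α i₁ ⋯ α iₘ * diam X`, for positive constants `c₁`, `c₂`. -/
def IsScalingDistance {ι X : Type*} (ψ : ι → X → X) (α : ι → ℝ) (d : MetricSpace X) : Prop :=
  Bornology.IsBounded (Set.univ : Set X) ∧
  ∃ c₁ > 0, ∃ c₂ > 0, ∀ w : List ι,
    c₁ * wordRatio α w * Metric.diam (Set.univ : Set X)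
        ≤ Metric.diam (wordMap ψ w '' Set.univ) ∧
    Metric.diam (wordMap ψ w '' Set.univ)
        ≤ c₂ * wordRatio α w * Metric.diam (Set.univ : Set X)

/-- `α` is metric if there is an `α`-self-similar distance. -/
def IsMetricPolyratio {ι X : Type*} (ψ : ι → X → X) (α : ι → ℝ) : Prop :=
  ∃ d : MetricSpace X, IsSelfSimilarDistance ψ α d

/-- `α` is asymptotically metric if there is an `α`-scaling distance. -/
def IsAsymptoticMetricPolyratio {ι X : Type*} (ψ : ι → X → X) (α : ι → ℝ) : Prop :=
  ∃ d : MetricSpace X, IsScalingDistance ψ α d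

/-! ### The Sierpinski gasket -/

/-- The vertices of an equilateral triangle with unit sides in the Euclidean plane. -/
noncomputable def gasketVertex : Fin 3 → EuclideanSpace ℝ (Fin 2) :=
  ![!₂[0, 0], !₂[1, 0], !₂[1 / 2, √3 / 2]]

/-- The contraction of the plane with ratio `1 / 2` that fixes the `i`-th vertex. -/
noncomputable def planeMap (i : Fin 3) (x : EuclideanSpace ℝ (Fin 2)) :
    EuclideanSpace ℝ (Fin 2) :=
  AffineMap.homothety (gasketVertex i) (1 / 2 : ℝ) x

/-- The `n`-th approximation of the gasket, starting from the full triangle. -/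
noncomputable def gasketLevel : ℕ → Set (EuclideanSpace ℝ (Fin 2))
  | 0 => convexHull ℝ (Set.range gasketVertex)
  | n + 1 => ⋃ i, planeMap i '' gasketLevel n

/-- The Sierpinski gasket; by the theorems below it is the only nonempty compact subset `K` of the
plane with `K = ⋃ i, planeMap i '' K`. -/
noncomputable def sierpinskiGasket : Set (EuclideanSpace ℝ (Fin 2)) :=
  ⋂ n, gasketLevel n

theorem planeMap_eq (i : Fin 3) (x : EuclideanSpace ℝ (Fin 2)) :
    planeMap i x = (1 / 2 : ℝ) • (x - gasketVertex i) + gasketVertex i := by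
  simp [planeMap, AffineMap.homothety_apply]

theorem dist_planeMap (i : Fin 3) (x y : EuclideanSpace ℝ (Fin 2)) :
    dist (planeMap i x) (planeMap i y) = (1 / 2) * dist x y := by
  rw [planeMap_eq, planeMap_eq, dist_add_right, dist_smul₀, dist_sub_right]
  norm_num

theorem continuous_planeMap (i : Fin 3) : Continuous (planeMap i) :=
  AffineMap.homothety_continuous _ _

theorem planeMap_injective (i : Fin 3) : Function.Injective (planeMap i) := by
  intro x y h
  have h1 := dist_planeMap i x y
  rw [h, dist_self] at h1
  exact dist_eq_zero.mp (by linarith)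

theorem planeMap_vertex (i : Fin 3) : planeMap i (gasketVertex i) = gasketVertex i := by
  simp [planeMap_eq]

theorem gasketLevel_succ_subset (n : ℕ) : gasketLevel (n + 1) ⊆ gasketLevel n := by
  induction n with
  | zero =>
    intro x hx
    simp only [gasketLevel, Set.mem_iUnion] at hx ⊢
    obtain ⟨i, y, hy, rfl⟩ := hx
    have h : (1 / 2 : ℝ) ∈ Set.Icc (0 : ℝ) 1 := ⟨by norm_num, by norm_num⟩
    exact (convex_convexHull ℝ _).lineMap_mem
      (subset_convexHull ℝ _ (Set.mem_range_self i)) hy h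
  | succ n ih =>
    exact Set.iUnion_mono fun i => Set.image_mono ih

theorem gasketLevel_antitone : Antitone gasketLevel :=
  antitone_nat_of_succ_le gasketLevel_succ_subset

theorem isCompact_gasketLevel (n : ℕ) : IsCompact (gasketLevel n) := by
  induction n with
  | zero => exact (Set.finite_range _).isCompact_convexHull ℝ
  | succ n ih => exact isCompact_iUnion fun i => ih.image (continuous_planeMap i)

theorem gasketVertex_mem (i : Fin 3) : gasketVertex i ∈ sierpinskiGasket := by
  refine Set.mem_iInter.mpr fun n => ?_
  induction n with
  | zero => exact subset_convexHull ℝ _ (Set.mem_range_self i)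
  | succ n ih => exact Set.mem_iUnion.mpr ⟨i, _, ih, planeMap_vertex i⟩

theorem sierpinskiGasket_nonempty : sierpinskiGasket.Nonempty :=
  ⟨_, gasketVertex_mem 0⟩

theorem isCompact_sierpinskiGasket : IsCompact sierpinskiGasket :=
  (isCompact_gasketLevel 0).of_isClosed_subset
    (isClosed_iInter fun n => (isCompact_gasketLevel n).isClosed) (Set.iInter_subset _ 0)

theorem planeMap_mapsTo (i : Fin 3) :
    Set.MapsTo (planeMap i) sierpinskiGasket sierpinskiGasket := by
  intro x hx
  refine Set.mem_iInter.mpr fun n => gasketLevel_succ_subset n ?_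
  exact Set.mem_iUnion.mpr ⟨i, x, Set.mem_iInter.mp hx n, rfl⟩

theorem sierpinskiGasket_eq_iUnion :
    sierpinskiGasket = ⋃ i, planeMap i '' sierpinskiGasket := by
  refine Set.Subset.antisymm (fun x hx => ?_)
    (Set.iUnion_subset fun i => (planeMap_mapsTo i).image_subset)
  by_contra hcon
  have key : ∀ i, ∃ n, x ∉ planeMap i '' gasketLevel n := by
    intro i
    by_contra! h
    obtain ⟨y, -, hyx⟩ := h 0
    refine hcon (Set.mem_iUnion.mpr ⟨i, y, Set.mem_iInter.mpr fun n => ?_, hyx⟩)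
    obtain ⟨z, hz, hzx⟩ := h n
    rwa [planeMap_injective i (hyx.trans hzx.symm)]
  choose N hN using key
  obtain ⟨i, hi⟩ := Set.mem_iUnion.mp (Set.mem_iInter.mp hx (Finset.univ.sup N + 1))
  exact hN i (Set.image_mono (gasketLevel_antitone (Finset.le_sup (Finset.mem_univ i))) hi)

theorem subset_of_eq_iUnion {K L : Set (EuclideanSpace ℝ (Fin 2))}
    (hK : IsCompact K) (hKe : K = ⋃ i, planeMap i '' K)
    (hL : IsCompact L) (hL0 : L.Nonempty) (hLe : L = ⋃ i, planeMap i '' L) : K ⊆ L := by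
  intro x hx
  obtain ⟨z, hz, hmax⟩ := hK.exists_isMaxOn ⟨x, hx⟩ (Metric.continuous_infDist_pt L).continuousOn
  have hz' := hz
  rw [hKe] at hz'
  obtain ⟨i, y, hy, rfl⟩ := Set.mem_iUnion.mp hz'
  obtain ⟨p, hp, hpy⟩ := hL.exists_infDist_eq_dist hL0 y
  have hpL : planeMap i p ∈ L := by
    rw [hLe]
    exact Set.mem_iUnion.mpr ⟨i, p, hp, rfl⟩
  have h1 := Metric.infDist_le_dist_of_mem (x := planeMap i y) hpL
  rw [dist_planeMap, ← hpy] at h1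
  have h2 : Metric.infDist y L ≤ Metric.infDist (planeMap i y) L := hmax hy
  have h3 : Metric.infDist x L ≤ Metric.infDist (planeMap i y) L := hmax hx
  have h4 := Metric.infDist_nonneg (x := x) (s := L)
  exact (hL.isClosed.mem_iff_infDist_zero hL0).mpr (by linarith)

theorem eq_sierpinskiGasket {K : Set (EuclideanSpace ℝ (Fin 2))} (hK : IsCompact K)
    (hK0 : K.Nonempty) (hKe : K = ⋃ i, planeMap i '' K) : K = sierpinskiGasket :=
  Set.Subset.antisymm
    (subset_of_eq_iUnion hK hKe isCompact_sierpinskiGasket sierpinskiGasket_nonempty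
      sierpinskiGasket_eq_iUnion)
    (subset_of_eq_iUnion isCompact_sierpinskiGasket sierpinskiGasket_eq_iUnion hK hK0 hKe)

/-- The three maps of the gasket into itself. -/
noncomputable def gasketMap (i : Fin 3) : sierpinskiGasket → sierpinskiGasket :=
  (planeMap_mapsTo i).restrict (planeMap i) sierpinskiGasket sierpinskiGasket

/-! ### Words -/

/-! Condition (c) is the hub: each of (a) and (b) is proved equivalent to it. Necessity: the fixed
points `a`, `b` of `ψ i`, `ψ j` are joined by a chain of two cells meeting at `ψ i b = ψ j a`. The
triangle inequality through that point gives `d a b ≤ (α i + α j) * d a b` for a self-similar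
distance. For a scaling distance the same splitting is iterated inside ever smaller cells, so `d a
b` is bounded by a constant times `(α i + α j) ^ m`, and a sum below `1` would force `a = b`.
Sufficiency: one distance serves both (a) and (b). It is defined by duality, as the supremum of `|f
x - f y|` over functions whose oscillation on each cell is at most the ratio of the cell. Pulling
such `f` back along `ψ i` and dividing by `α i` gives another one, so `ψ i` contracts by at least `α
i`. The reverse inequality, and the separation of points, rest on `exists_admissible_extension`: `α
i * g` on cell `i` extends to the other two cells by multiples of the vertex potentials of
`exists_vertexPotential`. Only the cell structure recorded in `IsGasketLike` is used; barycentric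
coordinates verify it for the gasket. -/

theorem wordMap_cons {ι X : Type*} (ψ : ι → X → X) (i : ι) (w : List ι) (x : X) :
    wordMap ψ (i :: w) x = ψ i (wordMap ψ w x) := rfl

theorem wordMap_nil {ι X : Type*} (ψ : ι → X → X) (x : X) : wordMap ψ [] x = x := rfl

theorem wordMap_append_singleton {ι X : Type*} (ψ : ι → X → X) (w : List ι) (i : ι) (x : X) :
    wordMap ψ (w ++ [i]) x = wordMap ψ w (ψ i x) := by
  induction w with
  | nil => rfl
  | cons j w ih => rw [List.cons_append, wordMap_cons, wordMap_cons, ih]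

theorem wordRatio_cons {ι : Type*} (α : ι → ℝ) (i : ι) (w : List ι) :
    wordRatio α (i :: w) = α i * wordRatio α w := by
  simp [wordRatio]

theorem wordRatio_nil {ι : Type*} (α : ι → ℝ) : wordRatio α [] = 1 := by
  simp [wordRatio]

theorem wordRatio_append_singleton {ι : Type*} (α : ι → ℝ) (w : List ι) (i : ι) :
    wordRatio α (w ++ [i]) = wordRatio α w * α i := by
  simp [wordRatio]

theorem IsPolyratio.wordRatio_pos {ι : Type*} {α : ι → ℝ} (hα : IsPolyratio α) (w : List ι) :
    0 < wordRatio α w := by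
  induction w with
  | nil => simp [wordRatio_nil]
  | cons i w ih => rw [wordRatio_cons]; exact mul_pos (hα i).1 ih

/-! ### Necessity of the condition -/

section Necessity

variable {ι X : Type*} {ψ : ι → X → X} {α : ι → ℝ} {d : MetricSpace X} {i j : ι} {a b : X}

/-- If two pieces `ψ i X` and `ψ j X` form a path between the fixed points of `ψ i` and `ψ j`,
then a self-similar distance forces `α i + α j ≥ 1`. -/
theorem IsSelfSimilarDistance.one_le_add (hd : IsSelfSimilarDistance ψ α d) (hab : a ≠ b)
    (ha : ψ i a = a) (hb : ψ j b = b) (h : ψ i b = ψ j a) : 1 ≤ α i + α j := by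
  have h1 := hd i a b
  have h2 := hd j a b
  rw [ha, h] at h1
  rw [hb] at h2
  have h3 := dist_triangle a (ψ j a) b
  have h4 : 0 < dist a b := dist_pos.mpr hab
  have h5 : dist a b ≤ (α i + α j) * dist a b := by rw [add_mul]; exact h3.trans (add_le_add h1 h2)
  by_contra! hlt
  nlinarith

/-- If two pieces `ψ i X` and `ψ j X` form a path between the fixed points of `ψ i` and `ψ j`,
then a scaling distance forces `α i + α j ≥ 1`. -/
theorem IsScalingDistance.one_le_add (hα : IsPolyratio α) (hd : IsScalingDistance ψ α d)
    (hab : a ≠ b) (ha : ψ i a = a) (hb : ψ j b = b) (h : ψ i b = ψ j a) : 1 ≤ α i + α j := by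
  obtain ⟨hbdd, _, -, c, -, hc⟩ := hd
  set C := c * Metric.diam (Set.univ : Set X) with hC
  -- Appending `i` or `j` splits the pair at the junction; each splitting costs a factor `α i + α
  -- j`, and `C` comes from the upper diameter bound.
  have key : ∀ (m : ℕ) (w : List ι), dist (wordMap ψ w a) (wordMap ψ w b)
      ≤ C * wordRatio α w * (α i + α j) ^ m := by
    intro m
    induction m with
    | zero =>
      intro w
      have h1 := Metric.dist_le_diam_of_mem (hbdd.subset (Set.subset_univ (wordMap ψ w '' Set.univ)))
        (Set.mem_image_of_mem _ (Set.mem_univ a)) (Set.mem_image_of_mem _ (Set.mem_univ b))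
      have h2 := (hc w).2
      rw [pow_zero, hC]
      linarith
    | succ m ih =>
      intro w
      have h1 := ih (w ++ [i])
      have h2 := ih (w ++ [j])
      rw [wordMap_append_singleton, wordMap_append_singleton, wordRatio_append_singleton] at h1 h2
      rw [ha, h] at h1
      rw [hb] at h2
      calc dist (wordMap ψ w a) (wordMap ψ w b)
          ≤ _ := dist_triangle _ (wordMap ψ w (ψ j a)) _
        _ ≤ _ := add_le_add h1 h2
        _ = _ := by ring
  by_contra! hlt
  have hpos : 0 ≤ α i + α j := (add_pos (hα i).1 (hα j).1).le
  have hlim := (tendsto_pow_atTop_nhds_zero_of_lt_one hpos hlt).const_mul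
    (C * wordRatio α ([] : List ι))
  rw [mul_zero] at hlim
  have h0 : dist a b ≤ 0 := ge_of_tendsto' hlim fun m => key m []
  exact hab (dist_le_zero.mp h0)

end Necessity

/-! ### Distances that are scaled exactly -/

/-- A bounded distance that every `ψ i` multiplies by `α i` is scaling. -/
theorem isScalingDistance_of_dist_eq {ι X : Type*} {ψ : ι → X → X} {α : ι → ℝ}
    (hα : IsPolyratio α) (d : MetricSpace X) (hbdd : ∃ C, ∀ x y : X, dist x y ≤ C)
    (h : ∀ i (x y : X), dist (ψ i x) (ψ i y) = α i * dist x y) : IsScalingDistance ψ α d := by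
  have hw : ∀ w (x y : X), dist (wordMap ψ w x) (wordMap ψ w y) = wordRatio α w * dist x y := by
    intro w x y
    induction w with
    | nil => simp [wordRatio_nil, wordMap_nil]
    | cons i w ih => rw [wordMap_cons, wordMap_cons, h, ih, wordRatio_cons, mul_assoc]
  have hB : ∀ s : Set X, Bornology.IsBounded s := by
    obtain ⟨C, hC⟩ := hbdd
    exact fun s => Metric.isBounded_iff.mpr ⟨C, fun x _ y _ => hC x y⟩
  refine ⟨hB _, 1, one_pos, 1, one_pos, fun w => ?_⟩
  have hpos := hα.wordRatio_pos w
  rw [one_mul]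
  constructor
  · rw [mul_comm, ← le_div_iff₀ hpos]
    refine Metric.diam_le_of_forall_dist_le (div_nonneg Metric.diam_nonneg hpos.le) fun x _ y _ => ?_
    rw [le_div_iff₀ hpos, mul_comm, ← hw]
    exact Metric.dist_le_diam_of_mem (hB _) (Set.mem_image_of_mem _ (Set.mem_univ x))
      (Set.mem_image_of_mem _ (Set.mem_univ y))
  · refine Metric.diam_le_of_forall_dist_le (mul_nonneg hpos.le Metric.diam_nonneg) ?_
    rintro _ ⟨x, -, rfl⟩ _ ⟨y, -, rfl⟩
    rw [hw]
    exact mul_le_mul_of_nonneg_left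
      (Metric.dist_le_diam_of_mem (hB _) (Set.mem_univ x) (Set.mem_univ y)) hpos.le

/-! ### The combinatorial structure of the gasket -/

/-- The maps `ψ i` cover `X` by three copies of it, any two of which meet in a single point, and
points are separated by cells of sufficiently high level. -/
structure IsGasketLike {X : Type*} (ψ : Fin 3 → X → X) (P : Fin 3 → X) : Prop where
  injective : ∀ i, Function.Injective (ψ i)
  cover : ∀ x, ∃ i y, ψ i y = x
  vertex_injective : Function.Injective P
  map_vertex : ∀ i, ψ i (P i) = P i
  junction : ∀ i j, ψ i (P j) = ψ j (P i)
  inter : ∀ i j x y, i ≠ j → ψ i x = ψ j y → x = P j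
  separated : ∀ x y, x ≠ y →
    ∃ n, ∀ w : List (Fin 3), w.length = n → ∀ u v, wordMap ψ w u = x → wordMap ψ w v ≠ y

/-- The functions whose oscillation on every cell is at most the ratio of the cell. -/
def admissibleFunctions {ι X : Type*} (ψ : ι → X → X) (α : ι → ℝ) : Set (X → ℝ) :=
  {f | ∀ w x y, |f (wordMap ψ w x) - f (wordMap ψ w y)| ≤ wordRatio α w}

section Admissible

variable {ι X : Type*} {ψ : ι → X → X} {α : ι → ℝ} {f : X → ℝ}

theorem abs_sub_le_one_of_admissible (hf : f ∈ admissibleFunctions ψ α) (x y : X) :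
    |f x - f y| ≤ 1 := by
  have h := hf [] x y
  rwa [wordRatio_nil] at h

theorem zero_mem_admissibleFunctions (hα : IsPolyratio α) :
    (0 : X → ℝ) ∈ admissibleFunctions ψ α := fun w x y => by
  simpa using (hα.wordRatio_pos w).le

/-- A nonempty word lies in a first-level cell, where oscillation is inherited from an admissible
function; only the empty word needs a global bound. -/
theorem admissible_of_cells (hα : IsPolyratio α) (h1 : ∀ x y, |f x - f y| ≤ 1)
    (h2 : ∀ i, ∃ g ∈ admissibleFunctions ψ α, ∃ c s : ℝ, |s| ≤ α i ∧ ∀ x, f (ψ i x) = c + s * g x) :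
    f ∈ admissibleFunctions ψ α := by
  rintro (_ | ⟨i, w⟩) x y
  · rw [wordRatio_nil]; exact h1 _ _
  · obtain ⟨g, hg, c, s, hs, hfg⟩ := h2 i
    rw [wordMap_cons, wordMap_cons, hfg, hfg, wordRatio_cons, add_sub_add_left_eq_sub, ← mul_sub,
      abs_mul]
    exact mul_le_mul hs (hg w x y) (abs_nonneg _) (hα i).1.le

theorem comp_div_mem_admissibleFunctions (hα : IsPolyratio α) (hf : f ∈ admissibleFunctions ψ α)
    (i : ι) : (fun x => f (ψ i x) / α i) ∈ admissibleFunctions ψ α := by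
  intro w x y
  have h := hf (i :: w) x y
  rw [wordRatio_cons, wordMap_cons, wordMap_cons] at h
  dsimp only
  rw [← sub_div, abs_div, abs_of_pos (hα i).1, div_le_iff₀ (hα i).1, mul_comm]
  exact h

end Admissible

/-- The largest distance between the values of an admissible function at two points. -/
noncomputable def potentialDist {ι X : Type*} (ψ : ι → X → X) (α : ι → ℝ) (x y : X) : ℝ :=
  sSup ((fun f : X → ℝ => |f x - f y|) '' admissibleFunctions ψ α)

/-! ### The dual distance and its scaling under the maps -/

section PotentialDist

variable {ι X : Type*} {ψ : ι → X → X} {α : ι → ℝ}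

theorem le_potentialDist {f : X → ℝ} (hf : f ∈ admissibleFunctions ψ α) (x y : X) :
    |f x - f y| ≤ potentialDist ψ α x y := by
  refine le_csSup ⟨1, ?_⟩ (Set.mem_image_of_mem _ hf)
  rintro _ ⟨g, hg, rfl⟩
  exact abs_sub_le_one_of_admissible hg x y

theorem potentialDist_le (hα : IsPolyratio α) {x y : X} {c : ℝ}
    (h : ∀ f ∈ admissibleFunctions ψ α, |f x - f y| ≤ c) : potentialDist ψ α x y ≤ c := by
  refine csSup_le (Set.Nonempty.image _ ⟨_, zero_mem_admissibleFunctions hα⟩) ?_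
  rintro _ ⟨g, hg, rfl⟩
  exact h g hg

/-- The potential distance, as a distance, when admissible functions separate points. -/
@[reducible]
noncomputable def potentialMetric (hα : IsPolyratio α)
    (hsep : ∀ x y, x ≠ y → ∃ f ∈ admissibleFunctions ψ α, f x ≠ f y) : MetricSpace X where
  dist := potentialDist ψ α
  dist_self x := le_antisymm (potentialDist_le hα fun f _ => by simp)
    ((abs_nonneg _).trans (le_potentialDist (zero_mem_admissibleFunctions hα) x x))
  dist_comm x y := by
    simp only [potentialDist, abs_sub_comm]
  dist_triangle x y z := potentialDist_le hα fun f hf =>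
    (abs_sub_le _ (f y) _).trans (add_le_add (le_potentialDist hf _ _) (le_potentialDist hf _ _))
  eq_of_dist_eq_zero {x y} h := by
    by_contra hne
    obtain ⟨f, hf, hfne⟩ := hsep x y hne
    have h1 := (le_potentialDist hf x y).trans h.le
    exact hfne (sub_eq_zero.mp (abs_nonpos_iff.mp h1))

theorem potentialDist_map_le (hα : IsPolyratio α) (i : ι) (x y : X) :
    potentialDist ψ α (ψ i x) (ψ i y) ≤ α i * potentialDist ψ α x y := by
  refine potentialDist_le hα fun f hf => ?_
  have h := le_potentialDist (comp_div_mem_admissibleFunctions hα hf i) x y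
  rwa [← sub_div, abs_div, abs_of_pos (hα i).1, div_le_iff₀ (hα i).1, mul_comm] at h

/-- Each competitor `g` for the pair `x`, `y` yields, by extension, a competitor for the image pair
with oscillation multiplied by `α i`. -/
theorem le_potentialDist_map (hα : IsPolyratio α) {i : ι}
    (hext : ∀ g ∈ admissibleFunctions ψ α, ∃ f ∈ admissibleFunctions ψ α,
      ∀ x, f (ψ i x) = α i * g x) (x y : X) :
    α i * potentialDist ψ α x y ≤ potentialDist ψ α (ψ i x) (ψ i y) := by
  rw [mul_comm, ← le_div_iff₀ (hα i).1]
  refine potentialDist_le hα fun g hg => ?_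
  obtain ⟨f, hf, hfg⟩ := hext g hg
  have h := le_potentialDist hf (ψ i x) (ψ i y)
  rwa [hfg, hfg, ← mul_sub, abs_mul, abs_of_pos (hα i).1, mul_comm, ← le_div_iff₀ (hα i).1] at h

end PotentialDist

/-! ### Gluing, vertex potentials and extension from a cell -/

namespace IsGasketLike

variable {X : Type*} {ψ : Fin 3 → X → X} {P : Fin 3 → X} {α : Fin 3 → ℝ}

/-- Functions on the three cells that agree at the junctions can be glued. -/
theorem exists_glue (hG : IsGasketLike ψ P) {β : Type*} (h : Fin 3 → X → β)
    (hm : ∀ i j, h i (P j) = h j (P i)) : ∃ f : X → β, ∀ i x, f (ψ i x) = h i x := by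
  choose c e hce using hG.cover
  refine ⟨fun x => h (c x) (e x), fun i x => ?_⟩
  have h1 := hce (ψ i x)
  dsimp only
  generalize c (ψ i x) = j at h1 ⊢
  generalize e (ψ i x) = y at h1 ⊢
  by_cases hi : j = i
  · subst hi
    rw [hG.injective j h1]
  · rw [hG.inter _ _ _ _ hi h1, hG.inter _ _ _ _ (Ne.symm hi) h1.symm, hm]

theorem eq_of_map_eq_vertex (hG : IsGasketLike ψ P) {i j : Fin 3} {x : X} (h : ψ j x = P i) :
    j = i := by
  by_contra hne
  have h1 := hG.inter i j (P i) x (Ne.symm hne) ((hG.map_vertex i).trans h.symm)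
  exact hne (hG.vertex_injective h1).symm

/-- A function that is `1` at one vertex, `0` at the other two, and affinely self-similar. -/
theorem exists_vertexPotential (hG : IsGasketLike ψ P) {a : ℝ} (ha : 0 < a) (ha1 : a < 1)
    (k : Fin 3) : ∃ f : X → ℝ, (∀ x, 0 ≤ f x ∧ f x ≤ 1) ∧ f (P k) = 1 ∧ (∀ i ≠ k, f (P i) = 0) ∧
      (∀ x, f (ψ k x) = 1 - a + a * f x) ∧ ∀ i ≠ k, ∀ x, f (ψ i x) = (1 - a) * f x := by
  choose c e hce using hG.cover
  have : Fact ((0 : ℝ) ≤ 1) := ⟨zero_le_one⟩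
  -- The functional equation is solved by Knaster–Tarski: its operator is monotone on `[0,
  -- 1]`-valued functions because `a` and `1 - a` are nonnegative. No topology on `X` is needed.
  let T : (X → Set.Icc (0 : ℝ) 1) →o (X → Set.Icc (0 : ℝ) 1) :=
    { toFun := fun f x => ⟨if c x = k then 1 - a + a * f (e x) else (1 - a) * f (e x), by
        obtain ⟨h0, h1⟩ := (f (e x)).2
        split_ifs <;> constructor <;> nlinarith⟩
      monotone' := by
        intro f g hfg x
        have h1 : (f (e x) : ℝ) ≤ g (e x) := hfg (e x)
        rw [← Subtype.coe_le_coe]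
        dsimp only
        split_ifs
        · exact add_le_add_right (mul_le_mul_of_nonneg_left h1 ha.le) _
        · exact mul_le_mul_of_nonneg_left h1 (by linarith) }
  have hfix := T.map_lfp
  obtain ⟨F, hF⟩ : ∃ F, F = T.lfp := ⟨_, rfl⟩
  rw [← hF] at hfix
  have hF' : ∀ x, (F x : ℝ) = if c x = k then 1 - a + a * F (e x) else (1 - a) * F (e x) :=
    fun x => by
      conv_lhs => rw [← hfix]
      rfl
  have hcP : ∀ i, c (P i) = i := fun i => hG.eq_of_map_eq_vertex (hce (P i))
  have heP : ∀ i, e (P i) = P i := fun i => by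
    have h1 := hce (P i)
    rw [hcP] at h1
    exact hG.injective i (h1.trans (hG.map_vertex i).symm)
  have hk : (F (P k) : ℝ) = 1 := by
    have h1 := hF' (P k)
    rw [hcP, heP, if_pos rfl] at h1
    have h2 : (1 - a) * ((F (P k) : ℝ) - 1) = 0 := by linarith
    rcases mul_eq_zero.mp h2 with h3 | h3 <;> linarith
  have hi : ∀ i ≠ k, (F (P i) : ℝ) = 0 := fun i hik => by
    have h1 := hF' (P i)
    rw [hcP, heP, if_neg hik] at h1
    have h2 : a * (F (P i) : ℝ) = 0 := by linarith
    exact (mul_eq_zero.mp h2).resolve_left ha.ne'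
  -- The chosen cell `c` matters only at a junction, where the formulas agree: cell `k` against
  -- another gives `1 - a + a * 0 = (1 - a) * 1`, and two cells other than `k` both give `0`.
  have hcell : ∀ i x, (F (ψ i x) : ℝ) = if i = k then 1 - a + a * F x else (1 - a) * F x := by
    intro i x
    have h1 := hce (ψ i x)
    rw [hF' (ψ i x)]
    generalize c (ψ i x) = j at h1 ⊢
    generalize e (ψ i x) = y at h1 ⊢
    by_cases hci : j = i
    · subst hci
      rw [hG.injective j h1]
    · rw [hG.inter _ _ _ _ hci h1, hG.inter _ _ _ _ (Ne.symm hci) h1.symm]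
      by_cases hik : i = k
      · subst hik
        rw [if_neg hci, if_pos rfl, hk, hi _ hci]; ring
      · rw [if_neg hik, hi i hik]
        by_cases hck : j = k
        · rw [if_pos hck, hck, hk]; ring
        · rw [if_neg hck, hi _ hck]
  refine ⟨fun x => F x, fun x => (F x).2, hk, hi, fun x => ?_, fun i hik x => ?_⟩
  · exact (hcell k x).trans (if_pos rfl)
  · exact (hcell i x).trans (if_neg hik)

/-- A function that is affinely self-similar with respect to a vertex is admissible. -/
theorem vertexPotential_admissible (hα : IsPolyratio α)
    (hc : ∀ i j : Fin 3, i ≠ j → 1 ≤ α i + α j) {k : Fin 3} {f : X → ℝ}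
    (h01 : ∀ x, 0 ≤ f x ∧ f x ≤ 1) (hk : ∀ x, f (ψ k x) = 1 - α k + α k * f x)
    (hi : ∀ i ≠ k, ∀ x, f (ψ i x) = (1 - α k) * f x) : f ∈ admissibleFunctions ψ α := by
  intro w x y
  induction w with
  | nil =>
    rw [wordRatio_nil, wordMap_nil, wordMap_nil, abs_le]
    constructor <;> linarith [(h01 x).1, (h01 x).2, (h01 y).1, (h01 y).2]
  | cons i w ih =>
    rw [wordMap_cons, wordMap_cons, wordRatio_cons]
    by_cases hik : i = k
    · subst hik
      rw [hk, hk, add_sub_add_left_eq_sub, ← mul_sub, abs_mul, abs_of_pos (hα i).1]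
      exact mul_le_mul_of_nonneg_left ih (hα i).1.le
    · rw [hi i hik, hi i hik, ← mul_sub, abs_mul, abs_of_pos (sub_pos.mpr (hα k).2)]
      -- The condition enters as `1 - α k ≤ α i`.
      exact mul_le_mul (by linarith [hc i k hik]) ih (abs_nonneg _) (hα i).1.le

/-- The vertex potential takes the value `1` at its vertex only. -/
theorem eq_vertex_of_vertexPotential_eq_one (hG : IsGasketLike ψ P) {a : ℝ} (ha : 0 < a)
    {k : Fin 3} {f : X → ℝ} (h01 : ∀ x, 0 ≤ f x ∧ f x ≤ 1)
    (hk : ∀ x, f (ψ k x) = 1 - a + a * f x) (hi : ∀ i ≠ k, ∀ x, f (ψ i x) = (1 - a) * f x)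
    (ha1 : a < 1) {x : X} (hx : f x = 1) : x = P k := by
  have hP : ∀ n, wordMap ψ (List.replicate n k) (P k) = P k := by
    intro n
    induction n with
    | zero => rfl
    | succ n ih => rw [List.replicate_succ, wordMap_cons, ih, hG.map_vertex]
  have hmem : ∀ n x, f x = 1 → ∃ z, wordMap ψ (List.replicate n k) z = x := by
    intro n
    induction n with
    | zero => exact fun x _ => ⟨x, rfl⟩
    | succ n ih =>
      intro x hx
      obtain ⟨i, y, rfl⟩ := hG.cover x
      by_cases hik : i = k
      · subst hik
        rw [hk] at hx
        have h2 : a * (f y - 1) = 0 := by linarith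
        obtain ⟨z, rfl⟩ := ih y (sub_eq_zero.mp ((mul_eq_zero.mp h2).resolve_left ha.ne'))
        exact ⟨z, rfl⟩
      · rw [hi i hik] at hx
        -- Off cell `k` the value is at most `1 - a < 1`.
        nlinarith [h01 y]
  by_contra hne
  obtain ⟨n, hn⟩ := hG.separated x (P k) hne
  obtain ⟨z, hz⟩ := hmem n x hx
  exact hn _ List.length_replicate z (P k) hz (hP n)

/-- An admissible function on a cell of the first level, scaled by the ratio of that cell, extends
to an admissible function. -/
theorem exists_admissible_extension (hG : IsGasketLike ψ P) (hα : IsPolyratio α)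
    (hc : ∀ i j : Fin 3, i ≠ j → 1 ≤ α i + α j) (i : Fin 3) {g : X → ℝ}
    (hg : g ∈ admissibleFunctions ψ α) :
    ∃ f ∈ admissibleFunctions ψ α, ∀ x, f (ψ i x) = α i * g x := by
  obtain ⟨j, k, hij, hik, hjk, hall⟩ : ∃ j k : Fin 3, i ≠ j ∧ i ≠ k ∧ j ≠ k ∧
      ∀ l, l = i ∨ l = j ∨ l = k := by
    revert i; decide
  obtain ⟨p, hp01, hpj, hp0, hp1, hp2⟩ := hG.exists_vertexPotential (hα j).1 (hα j).2 j
  obtain ⟨q, hq01, hqk, hq0, hq1, hq2⟩ := hG.exists_vertexPotential (hα k).1 (hα k).2 k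
  have hpA := vertexPotential_admissible hα hc hp01 hp1 hp2
  have hqA := vertexPotential_admissible hα hc hq01 hq1 hq2
  have hj0 := (hα j).1
  have hk0 := (hα k).1
  have hsum : 0 < α j + α k := add_pos hj0 hk0
  set u := α i * g (P j) with hu
  set v := α i * g (P k) with hv
  -- The jump from `u` to `v` is shared between cells `j` and `k` in proportion to their ratios, so
  -- that each gets a slope it can afford.
  set θ := α j / (α j + α k) with hθ
  have hθ0 : 0 ≤ θ := (div_pos hj0 hsum).le
  have hθ1 : 1 - θ = α k / (α j + α k) := by rw [hθ]; field_simp; ring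
  have hθ1' : 0 ≤ 1 - θ := by rw [hθ1]; exact (div_pos hk0 hsum).le
  -- The jump is at most `α i ≤ 1 ≤ α j + α k`, which is where the condition is used.
  have huv : |v - u| ≤ α j + α k := by
    rw [hu, hv, ← mul_sub, abs_mul, abs_of_pos (hα i).1]
    have h1 := abs_sub_le_one_of_admissible hg (P k) (P j)
    have h2 := mul_le_mul (hα i).2.le h1 (abs_nonneg _) zero_le_one
    linarith [hc j k hjk]
  have hsj : |θ * (v - u)| ≤ α j := by
    rw [abs_mul, abs_of_nonneg hθ0, hθ, div_mul_eq_mul_div, div_le_iff₀ hsum]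
    exact mul_le_mul_of_nonneg_left huv hj0.le
  have hsk : |(1 - θ) * (u - v)| ≤ α k := by
    rw [abs_mul, abs_of_nonneg hθ1', hθ1, div_mul_eq_mul_div, div_le_iff₀ hsum, abs_sub_comm]
    exact mul_le_mul_of_nonneg_left huv hk0.le
  -- On cell `j`, `q` is `0` at the junction with `i` and `1` at the one with `k`; `p` plays the
  -- mirrored role on cell `k`. Both reach `u + θ * (v - u)` at their common junction.
  let h : Fin 3 → X → ℝ := fun l x =>
    if l = i then α i * g x
    else if l = j then u + θ * (v - u) * q x else v + (1 - θ) * (u - v) * p x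
  have hhi : ∀ x, h i x = α i * g x := fun x => if_pos rfl
  have hhj : ∀ x, h j x = u + θ * (v - u) * q x := fun x => by
    simp only [h, if_neg hij.symm, if_true]
  have hhk : ∀ x, h k x = v + (1 - θ) * (u - v) * p x := fun x => by
    simp only [h, if_neg hik.symm, if_neg hjk.symm]
  have e1 : h i (P j) = h j (P i) := by rw [hhi, hhj, hq0 i hik]; ring
  have e2 : h i (P k) = h k (P i) := by rw [hhi, hhk, hp0 i hij]; ring
  have e3 : h j (P k) = h k (P j) := by rw [hhj, hhk, hqk, hpj]; ring
  obtain ⟨f, hf⟩ := hG.exists_glue h (by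
    intro l m
    rcases hall l with rfl | rfl | rfl <;> rcases hall m with rfl | rfl | rfl <;>
      first | rfl | assumption | (symm; assumption))
  have hfi : ∀ x, f (ψ i x) = α i * g x := fun x => (hf i x).trans (hhi x)
  have hfj : ∀ x, f (ψ j x) = u + θ * (v - u) * q x := fun x => (hf j x).trans (hhj x)
  have hfk : ∀ x, f (ψ k x) = v + (1 - θ) * (u - v) * p x := fun x => (hf k x).trans (hhk x)
  have conv : ∀ s t b r y : ℝ, 0 ≤ t → t ≤ 1 → |s - y| ≤ r → |b - y| ≤ r →
      |s + t * (b - s) - y| ≤ r := by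
    intro s t b r y ht0 ht1 hs hb
    rw [abs_le] at *
    constructor <;> nlinarith
  -- On cells `j` and `k` the values lie between `u` and `v`, themselves values of `α i * g`, so the
  -- extension does not enlarge the range's hull.
  have hull : ∀ x y r, (∀ z, |α i * g z - y| ≤ r) → |f x - y| ≤ r := by
    intro x y r hr
    obtain ⟨l, x, rfl⟩ := hG.cover x
    rcases hall l with rfl | rfl | rfl
    · rw [hfi]; exact hr x
    · rw [hfj, mul_right_comm]
      exact conv _ _ _ _ _ (mul_nonneg hθ0 (hq01 x).1)
        (mul_le_one₀ (by linarith) (hq01 x).1 (hq01 x).2) (hr _) (hr _)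
    · rw [hfk, mul_right_comm]
      exact conv _ _ _ _ _ (mul_nonneg hθ1' (hp01 x).1)
        (mul_le_one₀ (by linarith) (hp01 x).1 (hp01 x).2) (hr _) (hr _)
  refine ⟨f, admissible_of_cells hα (fun x y => ?_) (fun l => ?_), hfi⟩
  · refine hull x (f y) 1 fun z => ?_
    rw [abs_sub_comm]
    refine hull y (α i * g z) 1 fun z' => ?_
    rw [← mul_sub, abs_mul, abs_of_pos (hα i).1]
    exact mul_le_one₀ (hα i).2.le (abs_nonneg _) (abs_sub_le_one_of_admissible hg _ _)
  · rcases hall l with rfl | rfl | rfl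
    · exact ⟨g, hg, 0, α l, (abs_of_pos (hα l).1).le, fun x => by rw [hfi, zero_add]⟩
    · exact ⟨q, hqA, _, _, hsj, hfj⟩
    · exact ⟨p, hpA, _, _, hsk, hfk⟩

/-- Induction on the separating level: two points of one cell are pulled back and the function found
there is extended; otherwise a vertex potential separates them. -/
theorem exists_admissible_ne (hG : IsGasketLike ψ P) (hα : IsPolyratio α)
    (hc : ∀ i j : Fin 3, i ≠ j → 1 ≤ α i + α j) {x y : X} (hxy : x ≠ y) :
    ∃ f ∈ admissibleFunctions ψ α, f x ≠ f y := by
  obtain ⟨n, hn⟩ := hG.separated x y hxy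
  clear hxy
  induction n generalizing x y with
  | zero => exact absurd rfl (hn [] rfl x y rfl)
  | succ n ih =>
    obtain ⟨i, x, rfl⟩ := hG.cover x
    by_cases hy : ∃ y', ψ i y' = y
    · obtain ⟨y, rfl⟩ := hy
      obtain ⟨g, hg, hgne⟩ := ih (x := x) (y := y) fun w hw u v hu hv =>
        hn (i :: w) (by rw [List.length_cons, hw]) u v (by rw [wordMap_cons, hu])
          (by rw [wordMap_cons, hv])
      obtain ⟨f, hf, hfg⟩ := hG.exists_admissible_extension hα hc i hg
      exact ⟨f, hf, by rw [hfg, hfg]; exact fun h => hgne (mul_left_cancel₀ (hα i).1.ne' h)⟩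
    -- The potential of vertex `i` is at least `1 - α i` on cell `i` and at most that elsewhere.
    -- Equality forces `f y = 1`, so the second point is a junction with cell `i`, hence in it after
    -- all.
    · obtain ⟨f, hf01, -, -, hf1, hf2⟩ := hG.exists_vertexPotential (hα i).1 (hα i).2 i
      refine ⟨f, vertexPotential_admissible hα hc hf01 hf1 hf2, fun heq => hy ?_⟩
      obtain ⟨j, y, rfl⟩ := hG.cover y
      by_cases hji : j = i
      · exact ⟨y, by rw [hji]⟩
      · rw [hf1, hf2 j hji] at heq
        have h1 : (1 - α i) * (1 - f y) ≤ 0 := by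
          linarith [mul_nonneg (hα i).1.le (hf01 x).1]
        have h2 : 1 - f y ≤ 0 := by
          by_contra! h3
          exact absurd h1 (not_le.mpr (mul_pos (sub_pos.mpr (hα i).2) h3))
        have h3 := hG.eq_vertex_of_vertexPotential_eq_one (hα i).1 hf01 hf1 hf2 (hα i).2
          (le_antisymm (hf01 y).2 (by linarith))
        exact ⟨P j, by rw [h3, hG.junction]⟩

/-- If the ratios of any two cells have sum at least `1`, then there is a bounded distance that
every `ψ i` multiplies by `α i`. -/
theorem exists_metric (hG : IsGasketLike ψ P) (hα : IsPolyratio α)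
    (hc : ∀ i j : Fin 3, i ≠ j → 1 ≤ α i + α j) :
    ∃ d : MetricSpace X, (∃ C, ∀ x y : X, d.dist x y ≤ C) ∧
      ∀ i (x y : X), d.dist (ψ i x) (ψ i y) = α i * d.dist x y :=
  ⟨potentialMetric hα fun _ _ h => hG.exists_admissible_ne hα hc h,
    ⟨1, fun x y => potentialDist_le hα fun _ hf => abs_sub_le_one_of_admissible hf x y⟩,
    fun i x y => le_antisymm (potentialDist_map_le hα i x y)
      (le_potentialDist_map hα (fun _ hg => hG.exists_admissible_extension hα hc i hg) x y)⟩

theorem isMetricPolyratio_iff (hG : IsGasketLike ψ P) (hα : IsPolyratio α) :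
    IsMetricPolyratio ψ α ↔ ∀ i j : Fin 3, i ≠ j → 1 ≤ α i + α j := by
  constructor
  · rintro ⟨d, hd⟩ i j hij
    exact hd.one_le_add (hG.vertex_injective.ne hij) (hG.map_vertex i) (hG.map_vertex j)
      (hG.junction i j)
  · intro hc
    obtain ⟨d, -, hd⟩ := hG.exists_metric hα hc
    exact ⟨d, fun i x y => (hd i x y).le⟩

theorem isAsymptoticMetricPolyratio_iff (hG : IsGasketLike ψ P) (hα : IsPolyratio α) :
    IsAsymptoticMetricPolyratio ψ α ↔ ∀ i j : Fin 3, i ≠ j → 1 ≤ α i + α j := by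
  constructor
  · rintro ⟨d, hd⟩ i j hij
    exact hd.one_le_add hα (hG.vertex_injective.ne hij) (hG.map_vertex i) (hG.map_vertex j)
      (hG.junction i j)
  · intro hc
    obtain ⟨d, hC, hd⟩ := hG.exists_metric hα hc
    exact ⟨d, isScalingDistance_of_dist_eq hα d hC hd⟩

end IsGasketLike

/-! ### The Sierpinski gasket has this structure -/

/-- The barycentric coordinates of a point of the plane with respect to the vertices. -/
noncomputable def gasketCoord (i : Fin 3) (x : EuclideanSpace ℝ (Fin 2)) : ℝ :=
  ![1 - x 0 - x 1 / √3, x 0 - x 1 / √3, 2 * x 1 / √3] i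

theorem gasketCoord_vertex (i j : Fin 3) :
    gasketCoord i (gasketVertex j) = if i = j then 1 else 0 := by
  have h3 : √3 ≠ 0 := by positivity
  fin_cases i <;> fin_cases j <;> simp [gasketCoord, gasketVertex] <;> field_simp <;> norm_num

theorem gasketCoord_combination (i : Fin 3) (a b : ℝ) (hab : a + b = 1)
    (x y : EuclideanSpace ℝ (Fin 2)) :
    gasketCoord i (a • x + b • y) = a * gasketCoord i x + b * gasketCoord i y := by
  obtain rfl : b = 1 - a := by linarith
  fin_cases i <;> simp [gasketCoord] <;> ring

theorem gasketCoord_planeMap (i j : Fin 3) (x : EuclideanSpace ℝ (Fin 2)) :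
    gasketCoord i (planeMap j x) = (gasketCoord i x + if i = j then 1 else 0) / 2 := by
  have h : planeMap j x = (1 / 2 : ℝ) • x + (1 / 2 : ℝ) • gasketVertex j := by
    rw [planeMap_eq]; module
  rw [h, gasketCoord_combination i _ _ (by norm_num), gasketCoord_vertex]
  ring

theorem sum_gasketCoord (x : EuclideanSpace ℝ (Fin 2)) : ∑ i, gasketCoord i x = 1 := by
  simp [Fin.sum_univ_three, gasketCoord]
  ring

theorem eq_of_gasketCoord_eq {x y : EuclideanSpace ℝ (Fin 2)}
    (h : ∀ i, gasketCoord i x = gasketCoord i y) : x = y := by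
  have h3 : √3 ≠ 0 := by positivity
  have h1 := h 1
  have h2 := h 2
  simp only [gasketCoord, Matrix.cons_val] at h1 h2
  have e1 : x 1 = y 1 := by field_simp at h2; linarith
  rw [e1] at h1
  ext i
  fin_cases i
  · show x 0 = y 0
    linarith
  · exact e1

theorem gasketCoord_nonneg {x : EuclideanSpace ℝ (Fin 2)} (hx : x ∈ sierpinskiGasket) (i : Fin 3) :
    0 ≤ gasketCoord i x := by
  have hx0 : x ∈ convexHull ℝ (Set.range gasketVertex) := Set.mem_iInter.mp hx 0
  refine convexHull_min (t := {x | 0 ≤ gasketCoord i x}) ?_ ?_ hx0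
  · rintro _ ⟨j, rfl⟩
    rw [Set.mem_ofPred_eq, gasketCoord_vertex]
    split_ifs <;> norm_num
  · intro x hx y hy a b ha hb hab
    rw [Set.mem_ofPred_eq, gasketCoord_combination i a b hab]
    exact add_nonneg (mul_nonneg ha hx) (mul_nonneg hb hy)

theorem eq_gasketVertex_of_one_le {x : EuclideanSpace ℝ (Fin 2)} (hx : x ∈ sierpinskiGasket)
    {j : Fin 3} (h : 1 ≤ gasketCoord j x) : x = gasketVertex j := by
  have hs := sum_gasketCoord x
  have hn := gasketCoord_nonneg hx
  have h0 := hn 0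
  have h1 := hn 1
  have h2 := hn 2
  rw [Fin.sum_univ_three] at hs
  refine eq_of_gasketCoord_eq fun i => ?_
  rw [gasketCoord_vertex]
  fin_cases i <;> fin_cases j <;> simp at h ⊢ <;> linarith

theorem coe_gasketMap (i : Fin 3) (x : sierpinskiGasket) :
    (gasketMap i x : EuclideanSpace ℝ (Fin 2)) = planeMap i x := rfl

theorem dist_wordMap_gasketMap (w : List (Fin 3)) (x y : sierpinskiGasket) :
    dist (wordMap gasketMap w x) (wordMap gasketMap w y) = (1 / 2) ^ w.length * dist x y := by
  induction w with
  | nil => simp [wordMap_nil]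
  | cons i w ih =>
    rw [wordMap_cons, wordMap_cons, Subtype.dist_eq, coe_gasketMap, coe_gasketMap, dist_planeMap,
      ← Subtype.dist_eq, ih, List.length_cons, pow_succ]
    ring

theorem isGasketLike_gasketMap :
    IsGasketLike gasketMap fun i => ⟨gasketVertex i, gasketVertex_mem i⟩ where
  injective i x y h := Subtype.ext (planeMap_injective i (congrArg Subtype.val h))
  cover x := by
    obtain ⟨i, y, hy, hyx⟩ := Set.mem_iUnion.mp (sierpinskiGasket_eq_iUnion.subset x.2)
    exact ⟨i, ⟨y, hy⟩, Subtype.ext hyx⟩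
  vertex_injective i j h := by
    by_contra hij
    have h1 := gasketCoord_vertex i j
    have h2 : gasketVertex i = gasketVertex j := congrArg Subtype.val h
    rw [← h2, gasketCoord_vertex, if_pos rfl, if_neg hij] at h1
    exact one_ne_zero h1
  map_vertex i := Subtype.ext (planeMap_vertex i)
  junction i j := Subtype.ext (by
    rw [coe_gasketMap, coe_gasketMap, planeMap_eq, planeMap_eq]
    module)
  inter i j x y hij h := by
    -- Coordinate `j` is half that of `x` on the left and at least `1 / 2` on the right, so that of
    -- `x` is at least `1`.
    have h1 := congrArg (fun z : sierpinskiGasket => gasketCoord j z) h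
    simp only [coe_gasketMap, gasketCoord_planeMap, if_neg hij.symm, if_true] at h1
    exact Subtype.ext (eq_gasketVertex_of_one_le x.2 (by linarith [gasketCoord_nonneg y.2 j]))
  separated x y hxy := by
    have hpos : 0 < dist x y := dist_pos.mpr hxy
    -- A cell of level `n` has diameter at most `(1 / 2) ^ n` times that of the gasket, eventually
    -- less than `dist x y`.
    have hlim := (tendsto_pow_atTop_nhds_zero_of_lt_one (r := (1 / 2 : ℝ)) (by norm_num)
      (by norm_num)).mul_const (Metric.diam sierpinskiGasket)
    rw [zero_mul] at hlim
    obtain ⟨n, hn⟩ := (hlim.eventually_lt_const hpos).exists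
    refine ⟨n, fun w hw u v hu hv => ?_⟩
    have h1 := dist_wordMap_gasketMap w u v
    rw [hu, hv, hw] at h1
    have h2 : dist u v ≤ Metric.diam sierpinskiGasket :=
      Metric.dist_le_diam_of_mem isCompact_sierpinskiGasket.isBounded u.2 v.2
    have h3 := mul_le_mul_of_nonneg_left h2 (by positivity : (0 : ℝ) ≤ (1 / 2) ^ n)
    linarith

theorem mainTheorem4 (α : Fin 3 → ℝ) (hα : IsPolyratio α) :
    (IsMetricPolyratio gasketMap α ↔ ∀ i j : Fin 3, i ≠ j → 1 ≤ α i + α j) ∧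
    (IsAsymptoticMetricPolyratio gasketMap α ↔ ∀ i j : Fin 3, i ≠ j → 1 ≤ α i + α j) :=
  ⟨isGasketLike_gasketMap.isMetricPolyratio_iff hα,
    isGasketLike_gasketMap.isAsymptoticMetricPolyratio_iff hα⟩
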